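/- Let $k$ be a unital commutative ring. For $n\geq 0$ let $H_{n+1}=C_2^{n+1}\rtimes\Sigma_{n+1}$ be the hyperoctahedral group, where $C_2=\langle t\mid t^2=1\rangle$ and $\Sigma_{n+1}$ is the symmetric group on $[n]=\{0,\dots,n\}$; its elements are written $(z_0,\dots,z_n;\sigma)$, where $z_i\in C_2$ is the label given to the letter in place $i$, which is then moved to place $\sigma(i)$. The hyperoctahedral category $\Delta H$ has the sets $[n]$, $n\geq 0$, as objects; a morphism $[n]\to[m]$ is a pair $(\phi,g)$ with $\phi\colon[n]\to[m]$ order-preserving and $g\in H_{n+1}$, and $(\psi,h)\circ(\phi,g)=(\psi\circ h_\star(\phi),\ \phi^\star(h)\circ g)$. Here, for $h=(w_0,\dots,w_m;\tau)\in H_{m+1}$, the element $\phi^\star(h)\in H_{n+1}$ is the block permutation that moves the blocks $\phi^{-1}(j)$ as $\tau$ moves the letters $j$, reversing the block $\phi^{-1}(j)$ exactly when $w_j=t$, and labels each $i\in[n]$ by $w_{\phi(i)}$; and $h_\star(\phi)\colon[n]\to[m]$ is the order-preserving map with $h_\star(\phi)\circ\phi^\star(h)=\tau\circ\phi$ as maps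 of sets. For an associative unital $k$-algebra $A$ with an involution $a\mapsto\overline a$ (an anti-homomorphism of $k$-algebras that squares to the identity), the hyperoctahedral bar construction is the functor $\mathsf H_A\colon\Delta H\to\mathbf{Mod}_k$ with $[n]\mapsto A^{\otimes_k (n+1)}$ and $$\mathsf H_A\bigl(\phi,(z_0,\dots,z_n;\sigma)\bigr)(a_0\otimes\cdots\otimes a_n)=\bigotimes_{j=0}^{m}\ \prod_{i\in(\phi\circ\sigma)^{-1}(j)}^{<}a_i^{z_i},\qquad a^1=a,\quad a^t=\overline a,$$ where the factors of each product are ordered by increasing $\sigma(i)$ and an empty product is $1_A$. For a functor $G\colon\Delta H^{\mathrm{op}}\to\mathbf{Mod}_k$ and a functor $F\colon\Delta H\to\mathbf{Mod}_k$ let $G\otimes_{\Delta H}F$ be the quotient of $\bigoplus_{n\ge 0}G([n])\otimes_kF([n])$ by the $k$-submodule generated by all $G(\alpha)(x)\otimes y-x\otimes F(\alpha)(y)$, for $\alpha\colon[n]\to[m]$ in $\Delta H$, $x\in G([m])$ and $y\in F([n])$; let $\mathrm{Tor}^{\Delta H}_n(G,-)$ be the left derived functors of $G\otimes_{\Delta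 H}-$, and let $k^\star$ be the constant functor $\Delta H^{\mathrm{op}}\to\mathbf{Mod}_k$ with value $k$. The $n$-th hyperoctahedral homology of $A$ is $HO_n(A)=\mathrm{Tor}^{\Delta H}_n(k^\star,\mathsf H_A)$. **Proposition.** Equip $k$, as an algebra over itself, with the trivial involution $\overline a=a$. Then $HO_\star(k)$ is isomorphic to $k$ concentrated in degree zero: $HO_0(k)\cong k$ as $k$-modules, and $HO_n(k)=0$ for all $n\geq 1$. -/

import Mathlib

open CategoryTheory Opposite TensorProduct

universe u

/-! ## The hyperoctahedral groups and the hyperoctahedral category -/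

section Hyperoctahedral

/-- The hyperoctahedral group `H_{n+1} = C₂^{n+1} ⋊ Σ_{n+1}`. The group `C₂ = ⟨t ∣ t² = 1⟩` is
`ℤˣ = {1, -1}`, with `t = -1`. The element `(z₀, …, zₙ; σ)` acts on signed letters by giving the
letter at place `i` the label `z i` and then moving it to place `σ i`. -/
@[ext]
structure HyperoctGroup (n : ℕ) where
  label : Fin (n + 1) → ℤˣ
  perm : Equiv.Perm (Fin (n + 1))

namespace HyperoctGroup

variable {n m : ℕ}

instance : Mul (HyperoctGroup n) :=
  ⟨fun g h => ⟨fun i => g.label (h.perm i) * h.label i, g.perm * h.perm⟩⟩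

instance : One (HyperoctGroup n) := ⟨⟨fun _ => 1, 1⟩⟩

instance : Inv (HyperoctGroup n) := ⟨fun g => ⟨fun i => (g.label (g.perm⁻¹ i))⁻¹, g.perm⁻¹⟩⟩

@[simp] lemma mul_label (g h : HyperoctGroup n) (i : Fin (n + 1)) :
    (g * h).label i = g.label (h.perm i) * h.label i := rfl
@[simp] lemma mul_perm (g h : HyperoctGroup n) : (g * h).perm = g.perm * h.perm := rfl
@[simp] lemma one_label (i : Fin (n + 1)) : (1 : HyperoctGroup n).label i = 1 := rfl
@[simp] lemma one_perm : (1 : HyperoctGroup n).perm = 1 := rfl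
@[simp] lemma inv_label (g : HyperoctGroup n) (i : Fin (n + 1)) :
    (g⁻¹).label i = (g.label (g.perm⁻¹ i))⁻¹ := rfl
@[simp] lemma inv_perm (g : HyperoctGroup n) : (g⁻¹).perm = g.perm⁻¹ := rfl

instance : Group (HyperoctGroup n) :=
  Group.ofLeftAxioms
    (fun a b c => by ext <;> simp [mul_assoc])
    (fun a => by ext <;> simp)
    (fun a => by ext <;> simp)

/-- For `φ : [n] → [m]` in `Δ` and `h ∈ H_{m+1}`: the new place of `i ∈ [n]` when the blocks
`φ⁻¹(j)` of `[n]` are permuted like the letters `j` by `h`, each block whose letter has label `t`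
being reversed, is determined by comparing these keys lexicographically. -/
def blockKey (φ : Fin (n + 1) →o Fin (m + 1)) (h : HyperoctGroup m) (i : Fin (n + 1)) :
    Fin (m + 1) ×ₗ Fin (n + 1) :=
  toLex (h.perm (φ i), if h.label (φ i) = 1 then i else Fin.rev i)

/-- `φ^⋆(h) ∈ H_{n+1}`, for `φ : [n] → [m]` in `Δ` and `h ∈ H_{m+1}`: the block permutation
induced by `h`, reversing the blocks `φ⁻¹(j)` for which `j` is labelled `t`. Every element of the
block `φ⁻¹(j)` gets the label of `j`. -/
def pull (φ : Fin (n + 1) →o Fin (m + 1)) (h : HyperoctGroup m) : HyperoctGroup n where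
  label i := h.label (φ i)
  perm := (Tuple.sort (blockKey φ h))⁻¹

/-- `h_⋆(φ) : [n] → [m]`, for `φ : [n] → [m]` in `Δ` and `h ∈ H_{m+1}`: the unique
order-preserving map with `h_⋆(φ) ∘ φ^⋆(h) = h ∘ φ` on underlying sets. -/
def push (h : HyperoctGroup m) (φ : Fin (n + 1) →o Fin (m + 1)) : Fin (n + 1) →o Fin (m + 1) where
  toFun p := h.perm (φ ((pull φ h).perm⁻¹ p))
  monotone' p q hpq := by
    have h1 := Tuple.monotone_sort (blockKey φ h) hpq
    have h2 := Prod.Lex.monotone_fst _ _ h1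
    exact h2

@[simp] lemma pull_label (φ : Fin (n + 1) →o Fin (m + 1)) (h : HyperoctGroup m)
    (i : Fin (n + 1)) : (pull φ h).label i = h.label (φ i) := rfl

@[simp] lemma push_apply_pull (φ : Fin (n + 1) →o Fin (m + 1)) (h : HyperoctGroup m)
    (i : Fin (n + 1)) : push h φ ((pull φ h).perm i) = h.perm (φ i) := by
  simp [push]

lemma blockKey_injective (φ : Fin (n + 1) →o Fin (m + 1)) (h : HyperoctGroup m) :
    Function.Injective (blockKey φ h) := by
  intro i j hij
  have h0 := congrArg ofLex hij
  simp only [blockKey, ofLex_toLex, Prod.mk.injEq, EmbeddingLike.apply_eq_iff_eq] at h0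
  obtain ⟨h1, h2⟩ := h0
  rw [h1] at h2
  split_ifs at h2
  · exact h2
  · exact Fin.rev_injective h2

lemma pull_perm_lt_iff (φ : Fin (n + 1) →o Fin (m + 1)) (h : HyperoctGroup m)
    (i j : Fin (n + 1)) : (pull φ h).perm i < (pull φ h).perm j ↔
      h.perm (φ i) < h.perm (φ j) ∨
        (φ i = φ j ∧ if h.label (φ i) = 1 then i < j else j < i) := by
  have hs : StrictMono (blockKey φ h ∘ Tuple.sort (blockKey φ h)) :=
    (Tuple.monotone_sort _).strictMono_of_injective
      ((blockKey_injective φ h).comp (Equiv.injective _))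
  have h1 : (pull φ h).perm i < (pull φ h).perm j ↔ blockKey φ h i < blockKey φ h j := by
    rw [← hs.lt_iff_lt]
    simp [pull]
  rw [h1, blockKey, blockKey, Prod.Lex.toLex_lt_toLex]
  simp only [EmbeddingLike.apply_eq_iff_eq]
  refine or_congr_right (and_congr_right fun hij => ?_)
  rw [← hij]
  split_ifs
  · rfl
  · exact Fin.rev_lt_rev

end HyperoctGroup

/-- A permutation of `[n]` is determined by the order that it induces on `[n]`. -/
lemma Equiv.Perm.eq_of_lt_iff {n : ℕ} {σ τ : Equiv.Perm (Fin n)}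
    (h : ∀ i j, σ i < σ j ↔ τ i < τ j) : σ = τ := by
  have hm : StrictMono (fun p => τ (σ⁻¹ p)) := by
    intro p q hpq
    rw [← h]
    simpa using hpq
  have h1 : (fun p => τ (σ⁻¹ p)) = id := by
    have hr : Set.range (fun p => τ (σ⁻¹ p)) = Set.range (id : Fin n → Fin n) := by
      rw [Set.range_id]
      exact ((σ⁻¹).trans τ).surjective.range_eq
    exact (StrictMono.range_inj hm strictMono_id).1 hr
  ext i
  have h2 := congrFun h1 (σ i)
  have h3 : σ⁻¹ (σ i) = i := σ.symm_apply_apply i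
  simp only [h3, id] at h2
  rw [h2]

/-- The objects `[n] = {0, …, n}`, `n ≥ 0`, of the hyperoctahedral category `ΔH`. -/
structure DeltaH where
  dim : ℕ

namespace DeltaH

/-- A morphism `[n] → [m]` of `ΔH`: a pair `(φ, g)` of an order-preserving map `φ : [n] → [m]`
and an element `g` of `H_{n+1}`. -/
@[ext]
structure Hom (X Y : DeltaH) where
  map : Fin (X.dim + 1) →o Fin (Y.dim + 1)
  elt : HyperoctGroup X.dim

namespace Hom

variable {X Y Z W : DeltaH}

/-- The composite `(ψ, h) ∘ (φ, g) = (ψ ∘ h_⋆(φ), φ^⋆(h) ∘ g)`. -/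
def comp (f : Hom X Y) (f' : Hom Y Z) : Hom X Z where
  map := f'.map.comp (f'.elt.push f.map)
  elt := HyperoctGroup.pull f.map f'.elt * f.elt

/-- The identity `(id, 1)`. -/
def id (X : DeltaH) : Hom X X := ⟨OrderHom.id, 1⟩

/-- The underlying map of sets `φ ∘ σ` of `(φ, (z; σ))`. -/
def under (f : Hom X Y) (i : Fin (X.dim + 1)) : Fin (Y.dim + 1) := f.map (f.elt.perm i)

@[simp] lemma comp_under (f : Hom X Y) (f' : Hom Y Z) (i : Fin (X.dim + 1)) :
    (f.comp f').under i = f'.under (f.under i) := by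
  simp [comp, under]

@[simp] lemma comp_label (f : Hom X Y) (f' : Hom Y Z) (i : Fin (X.dim + 1)) :
    (f.comp f').elt.label i = f'.elt.label (f.under i) * f.elt.label i := by
  simp [comp, under]

lemma comp_perm_lt_iff (f : Hom X Y) (f' : Hom Y Z) (i j : Fin (X.dim + 1)) :
    (f.comp f').elt.perm i < (f.comp f').elt.perm j ↔
      f'.elt.perm (f.under i) < f'.elt.perm (f.under j) ∨
        (f.under i = f.under j ∧ if f'.elt.label (f.under i) = 1
          then f.elt.perm i < f.elt.perm j else f.elt.perm j < f.elt.perm i) := by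
  simp only [comp, HyperoctGroup.mul_perm, Equiv.Perm.mul_apply,
    HyperoctGroup.pull_perm_lt_iff, under]
  rfl

/-- A morphism is determined by its underlying map, its labels, and the induced order. -/
lemma ext_under {f f' : Hom X Y} (h1 : ∀ i, f.under i = f'.under i)
    (h2 : ∀ i, f.elt.label i = f'.elt.label i)
    (h3 : ∀ i j, f.elt.perm i < f.elt.perm j ↔ f'.elt.perm i < f'.elt.perm j) : f = f' := by
  have hp : f.elt.perm = f'.elt.perm := Equiv.Perm.eq_of_lt_iff h3
  have he : f.elt = f'.elt := HyperoctGroup.ext (funext h2) hp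
  refine Hom.ext ?_ he
  ext1
  funext p
  have := h1 (f.elt.perm⁻¹ p)
  unfold under at this
  rw [← hp] at this
  simpa using this

lemma id_comp (f : Hom X Y) : (id X).comp f = f := by
  refine ext_under (fun i => ?_) (fun i => ?_) (fun i j => ?_)
  · rw [comp_under]; rfl
  · simp [under, id]
  · rw [comp_perm_lt_iff]
    simp only [under, id, OrderHom.id_coe, HyperoctGroup.one_perm, Equiv.Perm.one_apply, id_eq,
      or_iff_left_iff_imp]
    rintro ⟨rfl, h⟩
    simp at h

lemma comp_id (f : Hom X Y) : f.comp (id Y) = f := by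
  refine ext_under (fun i => ?_) (fun i => ?_) (fun i j => ?_)
  · rw [comp_under]; rfl
  · simp [id]
  · rw [comp_perm_lt_iff]
    simp only [under, id, HyperoctGroup.one_perm, Equiv.Perm.one_apply,
      HyperoctGroup.one_label, if_true]
    constructor
    · rintro (h | h)
      · exact f.map.monotone.reflect_lt h
      · exact h.2
    · intro h
      rcases (f.map.monotone h.le).lt_or_eq with h' | h'
      · exact Or.inl h'
      · exact Or.inr ⟨h', h⟩

lemma assoc (f : Hom X Y) (f' : Hom Y Z) (f'' : Hom Z W) :
    (f.comp f').comp f'' = f.comp (f'.comp f'') := by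
  refine ext_under (fun i => ?_) (fun i => ?_) (fun i j => ?_)
  · simp
  · simp [mul_assoc]
  · rw [comp_perm_lt_iff, comp_perm_lt_iff, comp_perm_lt_iff, comp_perm_lt_iff,
      comp_perm_lt_iff, comp_under, comp_under, comp_label]
    by_cases h1 : f.under i = f.under j
    · rw [h1]
      rcases Int.units_eq_one_or (f''.elt.label (f'.under (f.under j))) with h | h <;>
      rcases Int.units_eq_one_or (f'.elt.label (f.under j)) with h' | h' <;>
      simp [h, h']
    · have h1' : ¬ f.under j = f.under i := fun h => h1 h.symm
      simp [h1, h1']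

end Hom

instance : SmallCategory DeltaH where
  Hom := Hom
  id := Hom.id
  comp := Hom.comp
  id_comp := Hom.id_comp
  comp_id := Hom.comp_id
  assoc := Hom.assoc

end DeltaH

end Hyperoctahedral

/-! ## Functor homology -/

noncomputable section FunctorHomology

namespace FunctorHomology

variable {k : Type u} [CommRing k] {C : Type} [SmallCategory C]

/-- The left `C`-module `k[Hom(c, -)]`. -/
def freeModule (k : Type u) [CommRing k] (c : C) : C ⥤ ModuleCat.{u} k where
  obj d := ModuleCat.of k ((c ⟶ d) →₀ k)
  map α := ModuleCat.ofHom (Finsupp.lmapDomain k k (fun β => β ≫ α))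
  map_id d := by
    ext : 1
    simp [Finsupp.lmapDomain, ← Finsupp.lmapDomain_id]
    rfl
  map_comp α β := by
    ext : 1
    simp only [ModuleCat.hom_ofHom, ModuleCat.hom_comp, ← Finsupp.lmapDomain_comp]
    congr 1
    funext γ
    simp

/-- The map `k[Hom(c, -)] → F` that corresponds to `x ∈ F(c)`. -/
def freeModuleDesc {F : C ⥤ ModuleCat.{u} k} {c : C} (x : F.obj c) : freeModule k c ⟶ F where
  app d := ModuleCat.ofHom (Finsupp.linearCombination k (fun β : c ⟶ d => F.map β x))
  naturality d e α := by
    ext : 1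
    apply Finsupp.lhom_ext
    intro β r
    simp [freeModule]

/-- The basis element `β` of `k[Hom(c, d)]`. -/
def freeGen (k : Type u) [CommRing k] {c d : C} (β : c ⟶ d) : (freeModule k c).obj d :=
  (Finsupp.single β 1 : (c ⟶ d) →₀ k)

lemma freeModule_map_gen {c d e : C} (β : c ⟶ d) (α : d ⟶ e) :
    (freeModule k c).map α (freeGen k β) = freeGen k (β ≫ α) :=
  Finsupp.mapDomain_single

lemma freeModuleDesc_app_gen {F : C ⥤ ModuleCat.{u} k} {c d : C} (x : F.obj c) (β : c ⟶ d) :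
    (freeModuleDesc x).app d (freeGen k β) = F.map β x :=
  (Finsupp.linearCombination_single k 1 β).trans (one_smul k _)

lemma freeModule_hom_ext {F : C ⥤ ModuleCat.{u} k} {c : C} {f g : freeModule k c ⟶ F}
    (h : f.app c (freeGen k (𝟙 c)) = g.app c (freeGen k (𝟙 c))) : f = g := by
  have key : ∀ (f : freeModule k c ⟶ F) {d : C} (β : c ⟶ d),
      f.app d (freeGen k β) = F.map β (f.app c (freeGen k (𝟙 c))) := by
    intro f d β
    have h := ConcreteCategory.congr_hom (f.naturality β) (freeGen k (𝟙 c))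
    rw [ConcreteCategory.comp_apply, ConcreteCategory.comp_apply, freeModule_map_gen,
      Category.id_comp] at h
    exact h
  ext d : 3
  refine Finsupp.lhom_ext' fun β => LinearMap.ext_ring ?_
  exact (key f β).trans ((congrArg (F.map β) h).trans (key g β).symm)

instance (c : C) : Projective (freeModule k c) where
  factors {E X} f e he := by
    have hs : Function.Surjective (e.app c) :=
      (ModuleCat.epi_iff_surjective _).1 inferInstance
    obtain ⟨x, hx⟩ := hs (f.app c (freeGen k (𝟙 c)))
    refine ⟨freeModuleDesc x, freeModule_hom_ext ?_⟩
    rw [NatTrans.comp_app, ConcreteCategory.comp_apply, freeModuleDesc_app_gen, CategoryTheory.Functor.map_id, ConcreteCategory.id_apply, hx]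

instance : EnoughProjectives (C ⥤ ModuleCat.{u} k) where
  presentation F := ⟨{
    p := ∐ fun y : (Σ c : C, F.obj c) => freeModule k y.1
    f := Limits.Sigma.desc fun y => freeModuleDesc y.2
    epi := by
      refine (NatTrans.epi_iff_epi_app _).2 fun c => (ModuleCat.epi_iff_surjective _).2 fun x => ?_
      refine ⟨(Limits.Sigma.ι (fun y : (Σ c : C, F.obj c) => freeModule k y.1) ⟨c, x⟩).app c
        (freeGen k (𝟙 c)), ?_⟩
      rw [← ConcreteCategory.comp_apply, ← NatTrans.comp_app, Limits.Sigma.ι_desc,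
        freeModuleDesc_app_gen, CategoryTheory.Functor.map_id, ConcreteCategory.id_apply] }⟩

open Classical in
/-- The relations `G(α)(x) ⊗ y - x ⊗ F(α)(y)` in `⨁_C G(C) ⊗ F(C)`. -/
def tensorRel (G : Cᵒᵖ ⥤ ModuleCat.{u} k) (F : C ⥤ ModuleCat.{u} k) :
    Submodule k (DirectSum C fun c => G.obj (op c) ⊗[k] F.obj c) :=
  Submodule.span k
    {v | ∃ (c d : C) (α : c ⟶ d) (x : G.obj (op d)) (y : F.obj c),
      v = DirectSum.lof k C (fun c => G.obj (op c) ⊗[k] F.obj c) c (G.map α.op x ⊗ₜ[k] y) -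
        DirectSum.lof k C (fun c => G.obj (op c) ⊗[k] F.obj c) d (x ⊗ₜ[k] F.map α y)}

/-- The tensor product `G ⊗_C F` of a right `C`-module `G` and a left `C`-module `F`. -/
abbrev tensorObj (G : Cᵒᵖ ⥤ ModuleCat.{u} k) (F : C ⥤ ModuleCat.{u} k) : Type u :=
  (DirectSum C fun c => G.obj (op c) ⊗[k] F.obj c) ⧸ tensorRel G F

/-- The map `⨁_C G(C) ⊗ F(C) → ⨁_C G(C) ⊗ F'(C)` induced by `Ψ : F → F'`. -/
def tensorSumMap (G : Cᵒᵖ ⥤ ModuleCat.{u} k) {F F' : C ⥤ ModuleCat.{u} k} (Ψ : F ⟶ F') :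
    (DirectSum C fun c => G.obj (op c) ⊗[k] F.obj c) →ₗ[k]
      DirectSum C fun c => G.obj (op c) ⊗[k] F'.obj c :=
  DirectSum.lmap fun c => LinearMap.lTensor (G.obj (op c)) (Ψ.app c).hom

lemma tensorRel_le_comap (G : Cᵒᵖ ⥤ ModuleCat.{u} k) {F F' : C ⥤ ModuleCat.{u} k} (Ψ : F ⟶ F') :
    tensorRel G F ≤ (tensorRel G F').comap (tensorSumMap G Ψ) := by
  classical
  refine Submodule.span_le.2 ?_
  rintro _ ⟨c, d, α, x, y, rfl⟩
  refine Submodule.subset_span ⟨c, d, α, x, Ψ.app c y, ?_⟩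
  have h : Ψ.app d (F.map α y) = F'.map α (Ψ.app c y) :=
    ConcreteCategory.congr_hom (Ψ.naturality α) y
  simp only [tensorSumMap, map_sub, DirectSum.lmap_lof, LinearMap.lTensor_tmul, ← h]

/-- The functor `G ⊗_C - : C ⥤ Mod_k ⥤ Mod_k`; `[x ⊗ y] ↦ [x ⊗ Ψ_C(y)]` on morphisms. -/
def tensorFunctor (G : Cᵒᵖ ⥤ ModuleCat.{u} k) : (C ⥤ ModuleCat.{u} k) ⥤ ModuleCat.{u} k where
  obj F := ModuleCat.of k (tensorObj G F)
  map Ψ := ModuleCat.ofHom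
    (Submodule.mapQ _ _ (tensorSumMap G Ψ) (tensorRel_le_comap G Ψ))
  map_id F := by
    classical
    ext : 1
    refine Submodule.linearMap_qext _ (DirectSum.linearMap_ext _ fun c => ?_)
    refine TensorProduct.ext' fun x y => ?_
    simp [tensorSumMap]
  map_comp Ψ Θ := by
    classical
    ext : 1
    refine Submodule.linearMap_qext _ (DirectSum.linearMap_ext _ fun c => ?_)
    refine TensorProduct.ext' fun x y => ?_
    simp [tensorSumMap]

lemma tensorSumMap_add (G : Cᵒᵖ ⥤ ModuleCat.{u} k) {F F' : C ⥤ ModuleCat.{u} k}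
    (Ψ Θ : F ⟶ F') : tensorSumMap G (Ψ + Θ) = tensorSumMap G Ψ + tensorSumMap G Θ := by
  classical
  refine DirectSum.linearMap_ext _ fun c => TensorProduct.ext' fun x y => ?_
  simp [tensorSumMap]

instance (G : Cᵒᵖ ⥤ ModuleCat.{u} k) : (tensorFunctor G).Additive where
  map_add {F F' Ψ Θ} := by
    ext : 1
    refine Submodule.linearMap_qext _ (LinearMap.ext fun v => ?_)
    change (tensorRel G F').mkQ (tensorSumMap G (Ψ + Θ) v) =
      (tensorRel G F').mkQ (tensorSumMap G Ψ v) + (tensorRel G F').mkQ (tensorSumMap G Θ v)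
    rw [tensorSumMap_add, LinearMap.add_apply, map_add]

/-- `Tor_n^C(G, F)`: the left derived functors of `G ⊗_C -`, evaluated at `F`. -/
def tor (n : ℕ) (G : Cᵒᵖ ⥤ ModuleCat.{u} k) (F : C ⥤ ModuleCat.{u} k) : ModuleCat.{u} k :=
  ((tensorFunctor G).leftDerived n).obj F

/-- The `k`-constant right `C`-module `k^⋆`. -/
def constRight (k : Type u) [CommRing k] (C : Type) [SmallCategory C] : Cᵒᵖ ⥤ ModuleCat.{u} k :=
  (Functor.const Cᵒᵖ).obj (ModuleCat.of k k)

end FunctorHomology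

end FunctorHomology

/-! ## The hyperoctahedral bar construction and hyperoctahedral homology -/

noncomputable section HyperoctahedralHomology

/-- An involution on an associative `k`-algebra `A`: an anti-homomorphism of `k`-algebras
`A → A` that squares to the identity. -/
structure AlgInvolution (k A : Type u) [CommRing k] [Ring A] [Algebra k A] extends A →ₗ[k] A where
  map_one' : toFun 1 = 1
  map_mul' : ∀ a b, toFun (a * b) = toFun b * toFun a
  involutive' : ∀ a, toFun (toFun a) = a

namespace AlgInvolution

/-- The trivial involution on the ground ring. -/
def trivial (k : Type u) [CommRing k] : AlgInvolution k k where
  toLinearMap := LinearMap.id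
  map_one' := rfl
  map_mul' a b := mul_comm a b
  involutive' _ := rfl

variable {k A : Type u} [CommRing k] [Ring A] [Algebra k A] (τ : AlgInvolution k A)

/-- `a^z`, which is `a` for `z = 1` and `ā` for `z = t`. -/
def act (z : ℤˣ) : A →ₗ[k] A := if z = 1 then LinearMap.id else τ.toLinearMap

@[simp] lemma act_one (a : A) : τ.act 1 a = a := by simp [act]
@[simp] lemma act_neg_one (a : A) : τ.act (-1) a = τ.toLinearMap a := by simp [act]

lemma act_mul (z w : ℤˣ) (a : A) : τ.act (w * z) a = τ.act w (τ.act z a) := by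
  rcases Int.units_eq_one_or z with rfl | rfl <;> rcases Int.units_eq_one_or w with rfl | rfl <;>
    simp
  exact (τ.involutive' a).symm

lemma act_list_prod (z : ℤˣ) (l : List A) :
    τ.act z l.prod =
      ((if z = 1 then l else l.reverse).map (τ.act z)).prod := by
  rcases Int.units_eq_one_or z with rfl | rfl
  · have : (τ.act 1 : A → A) = id := funext fun a => by simp
    simp [this]
  · simp only [show ¬ ((-1 : ℤˣ) = 1) by decide, if_false]
    induction l with
    | nil => simpa using τ.map_one'
    | cons a l ih =>
      have := τ.map_mul' a l.prod
      simp only [List.prod_cons, List.reverse_cons, List.map_append, List.prod_append, ← ih]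
      simpa using this

end AlgInvolution

namespace DeltaH

/-- The preimage `(φ ∘ σ)⁻¹(j)` of a morphism `(φ, (z; σ))`, listed in the order in which the
places `σ(i)` follow each other in the domain of `φ`. -/
def Hom.fiber {X Y : DeltaH} (f : Hom X Y) (j : Fin (Y.dim + 1)) : List (Fin (X.dim + 1)) :=
  ((List.finRange (X.dim + 1)).filter fun p => f.map p = j).map f.elt.perm.symm

namespace Hom

variable {X Y Z : DeltaH}

@[simp] lemma mem_fiber (f : Hom X Y) (j : Fin (Y.dim + 1)) (i : Fin (X.dim + 1)) :
    i ∈ f.fiber j ↔ f.under i = j := by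
  simp only [fiber, List.mem_map, List.mem_filter, List.mem_finRange, true_and, decide_eq_true_eq,
    under]
  constructor
  · rintro ⟨p, hp, rfl⟩
    simpa using hp
  · intro h
    exact ⟨_, h, by simp⟩

lemma pairwise_fiber (f : Hom X Y) (j : Fin (Y.dim + 1)) :
    (f.fiber j).Pairwise fun a b => f.elt.perm a < f.elt.perm b := by
  rw [fiber, List.pairwise_map]
  simp only [Equiv.apply_symm_apply]
  exact (List.pairwise_lt_finRange _).filter _

lemma nodup_fiber (f : Hom X Y) (j : Fin (Y.dim + 1)) : (f.fiber j).Nodup :=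
  (f.pairwise_fiber j).imp fun h => by rintro rfl; exact lt_irrefl _ h

lemma fiber_id (j : Fin (X.dim + 1)) : (Hom.id X).fiber j = [j] := by
  have h : ∀ i, i ∈ (Hom.id X).fiber j ↔ i = j := by
    intro i; simp [under, Hom.id]
  exact List.perm_singleton.1
    ((List.perm_ext_iff_of_nodup ((Hom.id X).nodup_fiber j) (List.nodup_singleton j)).2
      (by simpa using h))

lemma fiber_comp (f : Hom X Y) (f' : Hom Y Z) (l : Fin (Z.dim + 1)) :
    (f.comp f').fiber l = (f'.fiber l).flatMap fun j =>
      if f'.elt.label j = 1 then f.fiber j else (f.fiber j).reverse := by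
  have hmem : ∀ (j : Fin (Y.dim + 1)) (i : Fin (X.dim + 1)),
      i ∈ (if f'.elt.label j = 1 then f.fiber j else (f.fiber j).reverse) ↔ f.under i = j := by
    intro j i
    split_ifs <;> simp
  have hR : ((f'.fiber l).flatMap fun j =>
      if f'.elt.label j = 1 then f.fiber j else (f.fiber j).reverse).Pairwise
        fun a b => (f.comp f').elt.perm a < (f.comp f').elt.perm b := by
    rw [List.pairwise_flatMap]
    constructor
    · intro j _
      have key : ∀ a b, a ∈ f.fiber j → b ∈ f.fiber j →
          (if f'.elt.label j = 1 then f.elt.perm a < f.elt.perm b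
            else f.elt.perm b < f.elt.perm a) →
          (f.comp f').elt.perm a < (f.comp f').elt.perm b := by
        intro a b ha hb hab
        rw [mem_fiber] at ha hb
        rw [comp_perm_lt_iff, ha, hb]
        exact Or.inr ⟨rfl, hab⟩
      split_ifs with h
      · refine (f.pairwise_fiber j).imp_of_mem fun {a b} ha hb hab => key a b ha hb ?_
        rwa [if_pos h]
      · rw [List.pairwise_reverse]
        refine (f.pairwise_fiber j).imp_of_mem fun {a b} ha hb hab => key b a hb ha ?_
        rwa [if_neg h]
    · refine (f'.pairwise_fiber l).imp fun {j j'} hj a ha b hb => ?_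
      rw [hmem] at ha hb
      rw [comp_perm_lt_iff, ha, hb]
      exact Or.inl hj
  have hnd := hR.imp (S := (· ≠ ·)) fun h => by rintro rfl; exact lt_irrefl _ h
  refine List.Perm.eq_of_pairwise ?_ ((f.comp f').pairwise_fiber l) hR
    ((List.perm_ext_iff_of_nodup ((f.comp f').nodup_fiber l) hnd).2 fun i => ?_)
  · intro a b _ _ h1 h2
    exact absurd h1 (lt_asymm h2)
  · simp only [mem_fiber, comp_under, List.mem_flatMap, hmem]
    constructor
    · intro h; exact ⟨_, h, rfl⟩
    · rintro ⟨j, h, rfl⟩; exact h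

end Hom

variable {k A : Type u} [CommRing k] [Ring A] [Algebra k A] (τ : AlgInvolution k A)
  {X Y Z : DeltaH}

/-- The `j`-th tensor factor `∏^{<}_{i ∈ (φ ∘ σ)⁻¹(j)} a_i^{z_i}` of the image of
`a_0 ⊗ ⋯ ⊗ a_n` under `(φ, (z; σ))`. -/
def barFactor (f : Hom X Y) (a : Fin (X.dim + 1) → A) (j : Fin (Y.dim + 1)) : A :=
  ((f.fiber j).map fun i => τ.act (f.elt.label i) (a i)).prod

lemma barFactor_update (f : Hom X Y) (a : Fin (X.dim + 1) → A) (i : Fin (X.dim + 1)) :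
    ∃ L R : A, ∀ x, barFactor τ f (Function.update a i x) =
      Function.update (barFactor τ f a) (f.under i) (L * τ.act (f.elt.label i) x * R) := by
  have hi : i ∈ f.fiber (f.under i) := by simp
  obtain ⟨s, t, hst⟩ := List.append_of_mem hi
  have hnd := f.nodup_fiber (f.under i)
  rw [hst, List.nodup_append] at hnd
  obtain ⟨-, h2, h3⟩ := hnd
  have hs : i ∉ s := fun h => h3 i h i (by simp) rfl
  have ht : i ∉ t := (List.nodup_cons.1 h2).1
  refine ⟨(s.map fun i => τ.act (f.elt.label i) (a i)).prod,
    (t.map fun i => τ.act (f.elt.label i) (a i)).prod, fun x => ?_⟩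
  have hcongr : ∀ l : List (Fin (X.dim + 1)), i ∉ l →
      (l.map fun i' => τ.act (f.elt.label i') (Function.update a i x i')) =
        l.map fun i => τ.act (f.elt.label i) (a i) := by
    intro l hl
    refine List.map_congr_left fun p hp => ?_
    rw [Function.update_of_ne (by rintro rfl; exact hl hp)]
  funext j
  by_cases hj : j = f.under i
  · subst hj
    rw [Function.update_self, barFactor, hst, List.map_append, List.map_cons, hcongr s hs,
      hcongr t ht]
    simp [mul_assoc]
  · rw [Function.update_of_ne hj, barFactor, hcongr, barFactor]
    rw [Hom.mem_fiber]
    exact fun h => hj h.symm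

/-- The multilinear map `(a_0, …, a_n) ↦ ⊗_j ∏^{<}_{i ∈ (φ ∘ σ)⁻¹(j)} a_i^{z_i}`. -/
def barMultilinear (f : Hom X Y) :
    MultilinearMap k (fun _ : Fin (X.dim + 1) => A)
      (PiTensorProduct k fun _ : Fin (Y.dim + 1) => A) where
  toFun a := PiTensorProduct.tprod k (barFactor τ f a)
  map_update_add' {inst} a i x y := by
    rw [Subsingleton.elim inst (instDecidableEqFin _)]
    obtain ⟨L, R, h⟩ := barFactor_update τ f a i
    rw [h, h, h, map_add, mul_add, add_mul, MultilinearMap.map_update_add]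
  map_update_smul' {inst} a i c x := by
    rw [Subsingleton.elim inst (instDecidableEqFin _)]
    obtain ⟨L, R, h⟩ := barFactor_update τ f a i
    rw [h, h, map_smul, mul_smul_comm, smul_mul_assoc, MultilinearMap.map_update_smul]

lemma barFactor_id (a : Fin (X.dim + 1) → A) : barFactor τ (Hom.id X) a = a := by
  funext j
  rw [barFactor, Hom.fiber_id]
  simp [Hom.id]

lemma barFactor_comp (f : Hom X Y) (f' : Hom Y Z) (a : Fin (X.dim + 1) → A) :
    barFactor τ (f.comp f') a = barFactor τ f' (barFactor τ f a) := by
  funext l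
  have h1 : ∀ L : List (Fin (Y.dim + 1)),
      ((L.flatMap fun j => if f'.elt.label j = 1 then f.fiber j else (f.fiber j).reverse).map
        fun i => τ.act ((f.comp f').elt.label i) (a i)).prod =
      (L.map fun j => τ.act (f'.elt.label j) (barFactor τ f a j)).prod := by
    intro L
    induction L with
    | nil => simp
    | cons j L ih =>
      rw [List.flatMap_cons, List.map_append, List.prod_append, ih, List.map_cons, List.prod_cons]
      congr 1
      rw [barFactor, AlgInvolution.act_list_prod]
      have h2 : ∀ i ∈ f.fiber j, τ.act ((f.comp f').elt.label i) (a i) =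
          τ.act (f'.elt.label j) (τ.act (f.elt.label i) (a i)) := by
        intro i hi
        rw [Hom.mem_fiber] at hi
        rw [Hom.comp_label, hi, AlgInvolution.act_mul]
      congr 1
      split_ifs
      · rw [List.map_map]
        exact List.map_congr_left h2
      · rw [← List.map_reverse, List.map_map]
        exact List.map_congr_left fun i hi => h2 i (List.mem_reverse.1 hi)
  rw [barFactor, Hom.fiber_comp, h1, barFactor]

/-- The hyperoctahedral bar construction `H_A : ΔH ⥤ Mod_k`, `[n] ↦ A^{⊗ n+1}`. -/
def barConstruction : DeltaH ⥤ ModuleCat.{u} k where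
  obj X := ModuleCat.of k (PiTensorProduct k fun _ : Fin (X.dim + 1) => A)
  map f := ModuleCat.ofHom (PiTensorProduct.lift (barMultilinear τ f))
  map_id X := by
    ext : 1
    refine PiTensorProduct.ext (MultilinearMap.ext fun a => ?_)
    change PiTensorProduct.lift (barMultilinear τ (Hom.id X)) (PiTensorProduct.tprod k a) = _
    rw [PiTensorProduct.lift.tprod]
    change PiTensorProduct.tprod k (barFactor τ (Hom.id X) a) = _
    rw [barFactor_id]
    rfl
  map_comp f f' := by
    ext : 1
    refine PiTensorProduct.ext (MultilinearMap.ext fun a => ?_)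
    change PiTensorProduct.lift (barMultilinear τ (Hom.comp f f')) (PiTensorProduct.tprod k a) =
      PiTensorProduct.lift (barMultilinear τ f')
        (PiTensorProduct.lift (barMultilinear τ f) (PiTensorProduct.tprod k a))
    rw [PiTensorProduct.lift.tprod, PiTensorProduct.lift.tprod]
    change PiTensorProduct.tprod k (barFactor τ (Hom.comp f f') a) =
      PiTensorProduct.lift (barMultilinear τ f') (PiTensorProduct.tprod k (barFactor τ f a))
    rw [PiTensorProduct.lift.tprod, barFactor_comp]
    rfl

end DeltaH

/-- The `n`-th hyperoctahedral homology `HO_n(A) = Tor_n^{ΔH}(k^⋆, H_A)` of an involutive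
`k`-algebra `A`. -/
def hyperoctahedralHomology {k A : Type u} [CommRing k] [Ring A] [Algebra k A]
    (τ : AlgInvolution k A) (n : ℕ) : ModuleCat.{u} k :=
  FunctorHomology.tor n (FunctorHomology.constRight k DeltaH) (DeltaH.barConstruction τ)

end HyperoctahedralHomology

/-! For the trivial involution on `k`, multiplication identifies every `k^{⊗(n+1)}` with `k`, and
each morphism of `ΔH` merely regroups the factors of one commutative product. So the bar
construction is the constant functor `k` (`barConstructionTrivialIso`), and `HO_⋆(k)` is the
homology of the nerve of `ΔH` with coefficients in `k`.

The nerve is contractible: although `[0]` is neither initial nor terminal, there is a zigzag `𝟭 ⟶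
[0] ⊔ - ⟵ const [0]` (`toSucc`, `zeroToSucc`).

`isZero_tor_const_of_zigzag` carries out this contraction on resolutions instead of nerves. For a
projective resolution `P` of a constant functor `M`, restriction along `F = [0] ⊔ -` gives again a
resolution of `M`. The two natural transformations yield two chain maps `P ⟶ F^*P` over the identity
of `M`: one is induced by `𝟭 ⟶ F`, the other factors through `M` placed in degree zero. They are
homotopic by `nonempty_homotopy_zero`. After `k^⋆ ⊗ -`, the first has a left inverse, so the
identity of `k^⋆ ⊗ P` is homotopic to a map through a complex concentrated in degree zero.

In degree zero, `k^⋆ ⊗ -` is the colimit functor, and the colimit of a constant functor over the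
connected category `ΔH` is its value. -/

noncomputable section

/-! ### Comparison of a projective resolution with an exact image of a resolution. -/

namespace CategoryTheory.ProjectiveResolution

variable {D E : Type*} [Category D] [Abelian D] [Category E] [Abelian E]

/-- A chain map from a projective resolution to the image of a resolution under an exact functor
is null-homotopic as soon as its composite with the augmentation vanishes. -/
lemma nonempty_homotopy_zero {Y : D} (P : ProjectiveResolution Y) {Z : E}
    (Q : ProjectiveResolution Z) (T : E ⥤ D) [T.Additive] [T.PreservesHomology]
    (f : P.complex ⟶ (T.mapHomologicalComplex _).obj Q.complex)
    (hf : f.f 0 ≫ T.map (Q.π.f 0) = 0) : Nonempty (Homotopy f 0) := by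
  -- `φ` is `f.f` with its targets displayed as `T.obj _`, the form in which the exact sequences
  -- `e0` and `e` apply.
  obtain ⟨φ, hf'⟩ : ∃ φ : ∀ n, P.complex.X n ⟶ T.obj (Q.complex.X n), φ = f.f := ⟨_, rfl⟩
  have hφ : ∀ i j, φ i ≫ T.map (Q.complex.d i j) = P.complex.d i j ≫ φ j := by
    subst hf'
    exact f.comm
  have hφ0 : φ 0 ≫ T.map (Q.π.f 0) = 0 := by
    subst hf'
    exact hf
  -- Only the source has to be projective; of the target just exactness is used, and `T` preserves
  -- it.
  have e0 := Q.exact₀.map T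
  have e : ∀ n, _ := fun n => (Q.exact_succ n).map T
  obtain ⟨h0, w0⟩ : ∃ h0 : P.complex.X 0 ⟶ T.obj (Q.complex.X 1),
      h0 ≫ T.map (Q.complex.d 1 0) = φ 0 :=
    ⟨_, e0.liftFromProjective_comp (φ 0) hφ0⟩
  obtain ⟨h1, w1⟩ : ∃ h1 : P.complex.X 1 ⟶ T.obj (Q.complex.X 2),
      h1 ≫ T.map (Q.complex.d 2 1) = φ 1 - P.complex.d 1 0 ≫ h0 := by
    have c1 : (φ 1 - P.complex.d 1 0 ≫ h0) ≫ T.map (Q.complex.d 1 0) = 0 := by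
      refine (Preadditive.sub_comp ..).trans ?_
      rw [Category.assoc, w0, sub_eq_zero]
      exact hφ 1 0
    exact ⟨_, (e 0).liftFromProjective_comp _ c1⟩
  -- The defect `φ - d ≫ g'` is a cycle by the previous homotopy identity and `d ≫ d = 0`, so it
  -- lifts through the next differential.
  have step : ∀ (n : ℕ) (g : P.complex.X n ⟶ T.obj (Q.complex.X (n + 1)))
      (g' : P.complex.X (n + 1) ⟶ T.obj (Q.complex.X (n + 2))),
      φ (n + 1) = P.complex.d (n + 1) n ≫ g + g' ≫ T.map (Q.complex.d (n + 2) (n + 1)) →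
      ∃ g'' : P.complex.X (n + 2) ⟶ T.obj (Q.complex.X (n + 3)),
        φ (n + 2) = P.complex.d (n + 2) (n + 1) ≫ g' +
          g'' ≫ T.map (Q.complex.d (n + 3) (n + 2)) := by
    intro n g g' w
    have c : (φ (n + 2) - P.complex.d (n + 2) (n + 1) ≫ g') ≫
        T.map (Q.complex.d (n + 2) (n + 1)) = 0 := by
      have h : φ (n + 2) ≫ T.map (Q.complex.d (n + 2) (n + 1)) =
        P.complex.d (n + 2) (n + 1) ≫ φ (n + 1) := hφ (n + 2) (n + 1)
      refine (Preadditive.sub_comp ..).trans ?_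
      rw [h, w]
      simp
    obtain ⟨g'', w2⟩ : ∃ g'' : P.complex.X (n + 2) ⟶ T.obj (Q.complex.X (n + 3)),
        g'' ≫ T.map (Q.complex.d (n + 3) (n + 2)) =
          φ (n + 2) - P.complex.d (n + 2) (n + 1) ≫ g' :=
      ⟨_, (e (n + 1)).liftFromProjective_comp _ c⟩
    exact ⟨g'', by rw [w2]; exact (add_sub_cancel _ _).symm⟩
  subst hf'
  exact ⟨Homotopy.mkInductive f h0 w0.symm h1
    ((add_sub_cancel _ _).symm.trans (congrArg _ w1.symm)) fun n p =>
      ⟨(step n p.1 p.2.1 p.2.2).choose, (step n p.1 p.2.1 p.2.2).choose_spec⟩⟩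

end CategoryTheory.ProjectiveResolution

/-! ### The functor `k^⋆ ⊗_C -` as a colimit, and restriction along endofunctors. -/

namespace FunctorHomology

variable {k : Type u} [CommRing k] {C : Type} [SmallCategory C]

open Classical in
/-- The class of `y ∈ F(c)` in `k^⋆ ⊗_C F`. -/
def tensorConstMk (F : C ⥤ ModuleCat.{u} k) (c : C) :
    F.obj c →ₗ[k] (tensorFunctor (constRight k C)).obj F :=
  (tensorRel (constRight k C) F).mkQ ∘ₗ
    DirectSum.lof k C (fun c => (constRight k C).obj (op c) ⊗[k] F.obj c) c ∘ₗ
      TensorProduct.mk k ((constRight k C).obj (op c)) (F.obj c) (1 : k)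

/-- This is the defining relation of the tensor product at `x = 1`, since `k^⋆` sends every morphism
to the identity. -/
lemma tensorConstMk_map (F : C ⥤ ModuleCat.{u} k) {c d : C} (α : c ⟶ d) (y : F.obj c) :
    tensorConstMk F d (F.map α y) = tensorConstMk F c y := by
  classical
  symm
  refine (Submodule.Quotient.eq _).2 (Submodule.subset_span ⟨c, d, α, (1 : k), y, ?_⟩)
  rfl

lemma tensorConst_hom_ext {F : C ⥤ ModuleCat.{u} k} {M : ModuleCat.{u} k}
    {f g : (tensorFunctor (constRight k C)).obj F ⟶ M}
    (h : ∀ c (y : F.obj c), f (tensorConstMk F c y) = g (tensorConstMk F c y)) : f = g := by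
  classical
  ext : 1
  refine Submodule.linearMap_qext _ (DirectSum.linearMap_ext _ fun c => ?_)
  refine TensorProduct.ext (LinearMap.ext_ring (LinearMap.ext fun y => h c y))

/-- The cocone under `F` that is given by the classes of elements. -/
def tensorConstUnit (F : C ⥤ ModuleCat.{u} k) :
    F ⟶ (Functor.const C).obj ((tensorFunctor (constRight k C)).obj F) where
  app c := ModuleCat.ofHom (tensorConstMk F c)
  naturality c d α := by
    ext y
    exact tensorConstMk_map F α y

open Classical in
/-- The map out of `k^⋆ ⊗_C F` that is induced by a cocone under `F`. -/
def tensorConstDesc {F : C ⥤ ModuleCat.{u} k} {M : ModuleCat.{u} k}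
    (ψ : F ⟶ (Functor.const C).obj M) : (tensorFunctor (constRight k C)).obj F ⟶ M :=
  ModuleCat.ofHom <| (tensorRel (constRight k C) F).liftQ
    (DirectSum.toModule k C M fun c =>
      TensorProduct.lift (LinearMap.toSpanSingleton k (F.obj c →ₗ[k] M) (ψ.app c).hom))
    (by
      refine Submodule.span_le.2 ?_
      rintro _ ⟨c, d, α, x, y, rfl⟩
      have h : ψ.app d (F.map α y) = ψ.app c y :=
        ConcreteCategory.congr_hom (ψ.naturality α) y
      change _ = (0 : M)
      rw [map_sub, DirectSum.toModule_lof, DirectSum.toModule_lof, sub_eq_zero]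
      exact (congrArg (fun z => (show k from x) • z) h).symm)

lemma tensorConstDesc_mk {F : C ⥤ ModuleCat.{u} k} {M : ModuleCat.{u} k}
    (ψ : F ⟶ (Functor.const C).obj M) (c : C) (y : F.obj c) :
    tensorConstDesc ψ (tensorConstMk F c y) = ψ.app c y := by
  classical
  have h := DirectSum.toModule_lof k (N := M)
    (M := fun c => (constRight k C).obj (op c) ⊗[k] F.obj c)
    (φ := fun c => TensorProduct.lift
      (LinearMap.toSpanSingleton k (F.obj c →ₗ[k] M) (ψ.app c).hom)) c
    (TensorProduct.mk k ((constRight k C).obj (op c)) (F.obj c) (1 : k) y)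
  refine Eq.trans h ?_
  exact one_smul k (show M from ψ.app c y)

lemma tensorFunctor_map_mk {F F' : C ⥤ ModuleCat.{u} k} (Ψ : F ⟶ F') (c : C) (y : F.obj c) :
    (tensorFunctor (constRight k C)).map Ψ (tensorConstMk F c y) =
      tensorConstMk F' c (Ψ.app c y) := by
  classical
  change (tensorRel (constRight k C) F').mkQ (tensorSumMap _ Ψ (DirectSum.lof k C
    (fun c => (constRight k C).obj (op c) ⊗[k] F.obj c) c _)) = _
  rw [tensorSumMap, DirectSum.lmap_lof]
  rfl

/-- `k^⋆ ⊗_C -` is left adjoint to the formation of constant functors. -/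
def tensorConstAdj :
    tensorFunctor (constRight k C) ⊣ (Functor.const C : ModuleCat.{u} k ⥤ _) :=
  Adjunction.mkOfHomEquiv
    { homEquiv := fun F M =>
        { toFun := fun φ => tensorConstUnit F ≫ (Functor.const C).map φ
          invFun := tensorConstDesc
          left_inv := fun φ => tensorConst_hom_ext fun c y => tensorConstDesc_mk _ c y
          right_inv := fun ψ => by
            ext c y
            exact tensorConstDesc_mk ψ c y }
      homEquiv_naturality_left_symm := fun f g => tensorConst_hom_ext fun c y => by
        refine (tensorConstDesc_mk (f ≫ g) c y).trans (Eq.symm ?_)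
        rw [ConcreteCategory.comp_apply, tensorFunctor_map_mk]
        exact tensorConstDesc_mk g c (f.app c y)
      homEquiv_naturality_right := fun f g => by
        ext c y
        rfl }

/-- The canonical map `k^⋆ ⊗_C (P ∘ F) → k^⋆ ⊗_C P`. -/
def tensorConstRestrict (F : C ⥤ C) (P : C ⥤ ModuleCat.{u} k) :
    (tensorFunctor (constRight k C)).obj (F ⋙ P) ⟶ (tensorFunctor (constRight k C)).obj P :=
  tensorConstDesc (Functor.whiskerLeft F (tensorConstUnit P))

/-- Needed to make the restriction maps commute with the differentials of a resolution. -/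
lemma tensorConstRestrict_naturality (F : C ⥤ C) {P Q : C ⥤ ModuleCat.{u} k} (f : P ⟶ Q) :
    (tensorFunctor (constRight k C)).map (Functor.whiskerLeft F f) ≫ tensorConstRestrict F Q =
      tensorConstRestrict F P ≫ (tensorFunctor (constRight k C)).map f :=
  tensorConst_hom_ext fun c y => by
    rw [ConcreteCategory.comp_apply, ConcreteCategory.comp_apply, tensorFunctor_map_mk,
      tensorConstRestrict, tensorConstDesc_mk, tensorConstRestrict, tensorConstDesc_mk]
    exact (tensorFunctor_map_mk f (F.obj c) y).symm

/-- The class of `y` at `c` is also the class of its image under `η.app c`, so passing along `η`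
changes nothing in the colimit. -/
lemma map_whiskerRight_tensorConstRestrict {F : C ⥤ C} (η : 𝟭 C ⟶ F) (P : C ⥤ ModuleCat.{u} k) :
    (tensorFunctor (constRight k C)).map
        (show P ⟶ F ⋙ P from Functor.whiskerRight η P) ≫
      tensorConstRestrict F P = 𝟙 _ :=
  tensorConst_hom_ext fun c y => by
    rw [ConcreteCategory.comp_apply, tensorFunctor_map_mk,
      tensorConstRestrict, tensorConstDesc_mk]
    exact tensorConstMk_map P (η.app c) y

end FunctorHomology

/-! ### The zigzag `𝟭 ⟶ [0] ⊔ - ⟵ const [0]` on `ΔH`, and connectedness. -/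

namespace DeltaH

namespace Hom

variable {X Y Z : DeltaH}

/-- The morphism `[0] ⊔ f : [0] ⊔ [n] → [0] ⊔ [m]`. -/
def succ (f : Hom X Y) : Hom ⟨X.dim + 1⟩ ⟨Y.dim + 1⟩ where
  map :=
    { toFun := Fin.cases 0 fun i => (f.map i).succ
      monotone' := fun i j => by
        refine Fin.cases (fun _ => Fin.zero_le _) (fun i => ?_) i
        refine Fin.cases (fun h => absurd h (by simp)) (fun j h => ?_) j
        exact Fin.succ_le_succ_iff.2 (f.map.monotone (Fin.succ_le_succ_iff.1 h)) }
  elt :=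
    { label := Fin.cases 1 f.elt.label
      perm := Equiv.Perm.decomposeFin.symm (0, f.elt.perm) }

lemma succ_label_zero (f : Hom X Y) : f.succ.elt.label 0 = 1 := rfl

lemma succ_label_succ (f : Hom X Y) (i : Fin (X.dim + 1)) :
    f.succ.elt.label i.succ = f.elt.label i := rfl

lemma succ_perm_zero (f : Hom X Y) : f.succ.elt.perm 0 = 0 :=
  Equiv.Perm.decomposeFin_symm_apply_zero _ _

lemma succ_perm_succ (f : Hom X Y) (i : Fin (X.dim + 1)) :
    f.succ.elt.perm i.succ = (f.elt.perm i).succ :=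
  (Equiv.Perm.decomposeFin_symm_apply_succ _ _ _).trans (by simp)

lemma succ_under_zero (f : Hom X Y) : f.succ.under 0 = 0 := by
  rw [under, succ_perm_zero]; rfl

lemma succ_under_succ (f : Hom X Y) (i : Fin (X.dim + 1)) :
    f.succ.under i.succ = (f.under i).succ := by
  rw [under, succ_perm_succ]; rfl

lemma succ_id : (Hom.id X).succ = Hom.id ⟨X.dim + 1⟩ := by
  refine ext_under (fun i => ?_) (fun i => ?_) (fun i j => ?_)
  · induction i using Fin.cases with
    | zero => exact succ_under_zero _
    | succ i => exact succ_under_succ _ i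
  · induction i using Fin.cases with
    | zero => rfl
    | succ i => rfl
  · have h : ∀ i, (Hom.id X).succ.elt.perm i = i := by
      intro i
      induction i using Fin.cases with
      | zero => exact succ_perm_zero _
      | succ i => exact succ_perm_succ _ i
    rw [h, h]
    rfl

/-- The added letter has label `1`, stays in place `0` and is alone in its block, so block
permutations and reversals affect only the other letters. -/
lemma succ_comp (f : Hom X Y) (g : Hom Y Z) : (f.comp g).succ = f.succ.comp g.succ := by
  refine ext_under (fun i => ?_) (fun i => ?_) (fun i j => ?_)
  · rw [comp_under]
    induction i using Fin.cases with
    | zero => simp only [succ_under_zero]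
    | succ i => simp only [succ_under_succ, comp_under]
  · rw [comp_label]
    induction i using Fin.cases with
    | zero => simp only [succ_under_zero, succ_label_zero, mul_one]
    | succ i => simp only [succ_under_succ, succ_label_succ, comp_label]
  · rw [comp_perm_lt_iff]
    induction i using Fin.cases with
    | zero =>
      induction j using Fin.cases with
      | zero => simp
      | succ j => simp [succ_perm_zero, succ_perm_succ, succ_under_zero, succ_under_succ]
    | succ i =>
      induction j using Fin.cases with
      | zero =>
        simp [succ_perm_zero, succ_perm_succ, succ_under_zero, succ_under_succ]
      | succ j =>
        simp only [succ_perm_succ, succ_under_succ, succ_label_succ, Fin.succ_lt_succ_iff,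
          Fin.succ_inj, comp_perm_lt_iff]

end Hom

/-- The endofunctor `[0] ⊔ -` of `ΔH`. -/
def succFunctor : DeltaH ⥤ DeltaH where
  obj X := ⟨X.dim + 1⟩
  map f := Hom.succ f
  map_id _ := Hom.succ_id
  map_comp f g := Hom.succ_comp f g

/-- The inclusion of the second summand in `[0] ⊔ [n]`. -/
def toSucc : 𝟭 DeltaH ⟶ succFunctor where
  app X := (⟨⟨Fin.succ, fun _ _ h => Fin.succ_le_succ_iff.2 h⟩, 1⟩ : Hom X ⟨X.dim + 1⟩)
  naturality X Y f := by
    refine Hom.ext_under (fun i => ?_) (fun i => ?_) (fun i j => ?_)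
    · refine (Hom.comp_under _ _ i).trans (Eq.trans ?_ (Hom.comp_under _ _ i).symm)
      exact (Hom.succ_under_succ f i).symm
    · refine (Hom.comp_label _ _ i).trans (Eq.trans ?_ (Hom.comp_label _ _ i).symm)
      exact mul_comm _ _
    · refine (Hom.comp_perm_lt_iff f _ i j).trans
        (Iff.trans ?_ (Hom.comp_perm_lt_iff _ (Hom.succ f) i j).symm)
      have hu : ∀ i, (⟨⟨Fin.succ, fun _ _ h => Fin.succ_le_succ_iff.2 h⟩, 1⟩ :
        Hom X ⟨X.dim + 1⟩).under i = i.succ := fun _ => rfl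
      simp only [hu, Hom.succ_perm_succ, HyperoctGroup.one_perm, HyperoctGroup.one_label,
        Equiv.Perm.one_apply, if_true, Fin.succ_lt_succ_iff, Fin.succ_inj]
      -- One composite orders letters by their images and then by `f.elt.perm`, the other by
      -- `f.elt.perm` alone. They agree because `f.map` is monotone.
      constructor
      · rintro (h | h)
        · exact Or.inl (f.map.monotone.reflect_lt h)
        · exact Or.inl h.2
      · rintro (h | ⟨rfl, h⟩)
        · exact (f.map.monotone h.le).lt_or_eq.imp id fun h' => ⟨h', h⟩
        · split_ifs at h <;> exact absurd h (lt_irrefl _)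

/-- The inclusion of the first summand in `[0] ⊔ [n]`. -/
def zeroToSucc : (Functor.const DeltaH).obj (⟨0⟩ : DeltaH) ⟶ succFunctor where
  app X := (⟨⟨fun _ => 0, fun _ _ _ => le_rfl⟩, 1⟩ : Hom ⟨0⟩ ⟨X.dim + 1⟩)
  naturality X Y f := by
    refine Hom.ext_under (fun i => ?_) (fun i => ?_) (fun i j => ?_)
    · refine (Hom.comp_under _ _ i).trans (Eq.trans ?_ (Hom.comp_under _ _ i).symm)
      exact (Hom.succ_under_zero f).symm
    · refine (Hom.comp_label _ _ i).trans (Eq.trans ?_ (Hom.comp_label _ _ i).symm)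
      exact mul_comm _ _
    · have : i = j := Subsingleton.elim (α := Fin 1) i j
      subst this
      exact iff_of_false (lt_irrefl _) (lt_irrefl _)

instance : IsConnected DeltaH := by
  have : Nonempty DeltaH := ⟨⟨0⟩⟩
  refine zigzag_isConnected fun X Y => ?_
  have h : ∀ X : DeltaH, Zigzag X ⟨0⟩ := fun X =>
    Zigzag.of_hom (⟨⟨fun _ => 0, fun _ _ _ => le_rfl⟩, 1⟩ : Hom X ⟨0⟩)
  exact (h X).trans (h Y).symm

/-! ### The bar construction of `k` with the trivial involution. -/

variable {k : Type u} [CommRing k]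

lemma act_trivial (z : ℤˣ) (a : k) : (AlgInvolution.trivial k).act z a = a := by
  rcases Int.units_eq_one_or z with rfl | rfl
  · simp
  · rw [AlgInvolution.act_neg_one]; rfl

/-- The fibres of the underlying map partition the letters; commutativity of `k` makes the order
within each fibre irrelevant. This is the naturality of the identification with a constant functor.
-/
lemma prod_barFactor_trivial {X Y : DeltaH} (f : Hom X Y) (a : Fin (X.dim + 1) → k) :
    ∏ j, barFactor (AlgInvolution.trivial k) f a j = ∏ i, a i := by
  rw [← Finset.prod_fiberwise Finset.univ f.under a]
  refine Finset.prod_congr rfl fun j _ => ?_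
  have h : (f.fiber j).toFinset = Finset.univ.filter fun i => f.under i = j := by
    ext i; simp
  rw [← h, List.prod_toFinset _ (f.nodup_fiber j), barFactor]
  simp only [act_trivial]

variable (k) in
/-- For the trivial involution on `k` the hyperoctahedral bar construction is the constant
functor `k`. -/
def barConstructionTrivialIso :
    barConstruction (AlgInvolution.trivial k) ≅ (Functor.const DeltaH).obj (ModuleCat.of k k) :=
  NatIso.ofComponents
    (fun X => (PiTensorProduct.constantBaseRingEquiv
      (Fin (X.dim + 1)) k).toLinearEquiv.toModuleIso)
    (fun {X Y} f => by
      ext : 1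
      refine PiTensorProduct.ext (MultilinearMap.ext fun a => ?_)
      change PiTensorProduct.constantBaseRingEquiv _ k
        (PiTensorProduct.lift (barMultilinear _ f) (PiTensorProduct.tprod k a)) =
          PiTensorProduct.constantBaseRingEquiv _ k (PiTensorProduct.tprod k a)
      rw [PiTensorProduct.lift.tprod]
      change PiTensorProduct.constantBaseRingEquiv _ k
        (PiTensorProduct.tprod k (barFactor _ f a)) = _
      rw [PiTensorProduct.constantBaseRingEquiv_tprod, PiTensorProduct.constantBaseRingEquiv_tprod,
        prod_barFactor_trivial])

end DeltaH

/-! ### `Tor` of `k^⋆` against a constant functor. -/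

lemma ChainComplex.exists_f_zero_eq {V : Type*} [Category V] [Limits.HasZeroMorphisms V]
    [Limits.HasZeroObject V] (Q : ChainComplex V ℕ) {A : V} (s : A ⟶ Q.X 0) :
    ∃ S : (ChainComplex.single₀ V).obj A ⟶ Q, S.f 0 = s :=
  ⟨(ChainComplex.fromSingle₀Equiv Q A).symm s, ChainComplex.fromSingle₀Equiv_symm_apply_f_zero s⟩

namespace FunctorHomology

variable {k : Type u} [CommRing k] {C : Type} [SmallCategory C]

/-- If the identity of `C` is linked by natural transformations `𝟭 ⟶ F ⟵ const c₀` to a constant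
functor, then `Tor` of `k^⋆` against a constant functor vanishes in positive degrees. -/
lemma isZero_tor_const_of_zigzag {F : C ⥤ C} {c₀ : C} (η : 𝟭 C ⟶ F)
    (ε : (Functor.const C).obj c₀ ⟶ F) (M : ModuleCat.{u} k) [Projective M] (n : ℕ) (hn : 1 ≤ n) :
    Limits.IsZero (tor n (constRight k C) ((Functor.const C).obj M)) := by
  let L := tensorFunctor (constRight k C)
  let T : (C ⥤ ModuleCat.{u} k) ⥤ (C ⥤ ModuleCat.{u} k) := (Functor.whiskeringLeft C C _).obj F
  let P := projectiveResolution ((Functor.const C).obj M : C ⥤ ModuleCat.{u} k)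
  let p : P.complex.X 0 ⟶ (Functor.const C).obj M := P.π.f 0
  have : Epi p := inferInstanceAs (Epi (P.π.f 0))
  -- Projectivity of `M` splits the augmentation at the single object `c₀`; `ε` then spreads this
  -- splitting over all of `C`, at the cost of replacing `P` by its restriction along `F`.
  let s₀ : M ⟶ (P.complex.X 0).obj c₀ := Projective.factorThru (𝟙 M) (p.app c₀)
  have hs₀ : s₀ ≫ p.app c₀ = 𝟙 M := Projective.factorThru_comp _ _
  let s : (Functor.const C).obj M ⟶ F ⋙ P.complex.X 0 :=
    (Functor.const C).map s₀ ≫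
      (show (Functor.const C).obj ((P.complex.X 0).obj c₀) ⟶ F ⋙ P.complex.X 0 from
        { app := fun c => (P.complex.X 0).map (ε.app c)
          naturality := fun c d α => by
            have h : 𝟙 c₀ ≫ ε.app d = ε.app c ≫ F.map α := ε.naturality α
            dsimp
            rw [← Functor.map_comp, ← h, Category.id_comp, Category.id_comp] })
  -- `T` fixes constant functors, so `s` is a section of the augmentation of the restricted
  -- resolution.
  have hs : s ≫ T.map p = 𝟙 _ := by
    ext c : 2
    have h : (P.complex.X 0).map (ε.app c) ≫ p.app (F.obj c) = p.app c₀ :=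
      (p.naturality (ε.app c)).trans (Category.comp_id _)
    change (s₀ ≫ (P.complex.X 0).map (ε.app c)) ≫ p.app (F.obj c) = 𝟙 M
    rw [Category.assoc, h, hs₀]
  let H : P.complex ⟶ (T.mapHomologicalComplex _).obj P.complex :=
    { f := fun i => Functor.whiskerRight η (P.complex.X i)
      comm' := fun i j _ => by
        ext c : 2
        exact (P.complex.d i j).naturality (η.app c) }
  -- No compatibility of `s` with differentials is required, as the source is zero in positive
  -- degrees.
  obtain ⟨S, hS⟩ := ChainComplex.exists_f_zero_eq
    ((T.mapHomologicalComplex (ComplexShape.down ℕ)).obj P.complex) s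
  -- Both `H` and `P.π ≫ S` cover the identity of the constant functor, so their difference is
  -- killed by the augmentation.
  have h0 : (H - P.π ≫ S).f 0 ≫ T.map (P.π.f 0) = 0 := by
    have h1 : H.f 0 ≫ T.map p = p := by
      ext c : 2
      exact (p.naturality (η.app c)).trans (Category.comp_id _)
    have h3 : (P.π ≫ S).f 0 ≫ T.map p = p := by
      change (p ≫ S.f 0) ≫ T.map p = p
      rw [hS]
      exact (Category.assoc _ _ _).trans ((congrArg (p ≫ ·) hs).trans (Category.comp_id p))
    refine (Preadditive.sub_comp ..).trans ?_
    exact sub_eq_zero.2 (h1.trans h3.symm)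
  obtain ⟨h⟩ := P.nonempty_homotopy_zero P T _ h0
  let ρ : (L.mapHomologicalComplex _).obj ((T.mapHomologicalComplex _).obj P.complex) ⟶
      (L.mapHomologicalComplex _).obj P.complex :=
    { f := fun i => tensorConstRestrict F (P.complex.X i)
      comm' := fun i j _ => (tensorConstRestrict_naturality F (P.complex.d i j)).symm }
  have hρ : (L.mapHomologicalComplex _).map H ≫ ρ = 𝟙 _ := by
    ext i : 1
    exact map_whiskerRight_tensorConstRestrict η (P.complex.X i)
  -- The identity is `L(H) ≫ ρ`, and replacing `H` by the homotopic `P.π ≫ S` makes it factor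
  -- through a complex concentrated in degree zero.
  let e : Homotopy (𝟙 ((L.mapHomologicalComplex _).obj P.complex))
      ((L.mapHomologicalComplex _).map P.π ≫ (L.mapHomologicalComplex _).map S ≫ ρ) :=
    (Homotopy.ofEq hρ.symm).trans <|
      ((L.mapHomotopy (Homotopy.equivSubZero.symm h)).compRight ρ).trans <|
        Homotopy.ofEq (by rw [Functor.map_comp, Category.assoc])
  refine Limits.IsZero.of_iso ?_ (P.isoLeftDerivedObj L n)
  rw [Limits.IsZero.iff_id_eq_zero]
  have hz : Limits.IsZero (((L.mapHomologicalComplex (ComplexShape.down ℕ)).obj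
      ((ChainComplex.single₀ _).obj ((Functor.const C).obj M))).homology n) := by
    refine ((HomologicalComplex.exactAt_iff_isZero_homology _ _).1 ?_)
    exact ShortComplex.exact_of_isZero_X₂ _ (L.map_isZero
      (HomologicalComplex.isZero_single_obj_X _ _ _ _ (by omega)))
  -- On homology in degree `n ≥ 1` the identity factors through the zero object `hz`.
  have he := e.homologyMap_eq n
  rw [HomologicalComplex.homologyMap_id, HomologicalComplex.homologyMap_comp,
    hz.eq_of_tgt (HomologicalComplex.homologyMap _ n) 0, Limits.zero_comp] at he
  exact he

/-- Over a connected category, `Tor_0` of `k^⋆` against the constant functor `M` is `M`. -/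
def torZeroConstIso [IsConnected C] (M : ModuleCat.{u} k) :
    tor 0 (constRight k C) ((Functor.const C).obj M) ≅ M :=
  -- A left adjoint is right exact, so its zeroth left derived functor is the functor itself.
  haveI : Limits.PreservesFiniteColimits (tensorFunctor (constRight k C)) :=
    haveI := (tensorConstAdj (k := k) (C := C)).leftAdjoint_preservesColimits
    inferInstance
  (tensorFunctor (constRight k C)).leftDerivedZeroIsoSelf.app _ ≪≫
    -- The counit is invertible because the constant-functor embedding, a right adjoint, is fully
    -- faithful for connected `C`.
    asIso (tensorConstAdj.counit.app M)

end FunctorHomology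

end

theorem mainTheorem10 (k : Type u) [CommRing k] :
    Nonempty (hyperoctahedralHomology (AlgInvolution.trivial k) 0 ≅ ModuleCat.of k k) ∧
      ∀ n : ℕ, 1 ≤ n →
        Limits.IsZero (hyperoctahedralHomology (AlgInvolution.trivial k) n) := by
  let e (n : ℕ) := ((FunctorHomology.tensorFunctor
    (FunctorHomology.constRight k DeltaH)).leftDerived n).mapIso
      (DeltaH.barConstructionTrivialIso k)
  refine ⟨⟨e 0 ≪≫ FunctorHomology.torZeroConstIso _⟩, fun n hn => ?_⟩
  have : Projective (ModuleCat.of k k) :=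
    (IsProjective.iff_projective (R := k) k).1 inferInstance
  exact (FunctorHomology.isZero_tor_const_of_zigzag DeltaH.toSucc DeltaH.zeroToSucc
    (ModuleCat.of k k) n hn).of_iso (e n)
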